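/- Let $(M,g)$ be a spacetime, i.e. a smooth ($C^\infty$, Hausdorff, second countable, finite-dimensional) manifold with a smooth Lorentzian metric $g$ of signature $(-,+,\dots,+)$ and a time orientation given by a continuous timelike vector field. A future-directed (past-directed) causal curve is a path $\gamma\colon[a,b]\to M$, $a<b$, that is locally Lipschitz with respect to every Riemannian metric on $M$ and whose velocity $\dot\gamma$ is, almost everywhere, a nonzero future-directed (past-directed) timelike or null vector. Write $p\le q$ if $p=q$ or there is a future-directed causal curve from $p$ to $q$. A time function is a continuous $\tau\colon M\to\mathbb{R}$ with $\tau(p)<\tau(q)$ whenever $p\le q$ and $p\ne q$. It is admissible if for some Riemannian metric $h$ on $M$, with distance $d_h$ (equivalently, for every such $h$), each point of $M$ has a neighborhood $U$ and a constant $C\ge 1$ such that $$p,q\in U,\ p\le q\ \Longrightarrow\ \tfrac1C\, d_h(p,q)\le \tau(q)-\tau(p)\le C\, d_h(p,q).$$ A piecewise causal path is a path $\beta\colon[a,b]\to M$ together with a partition $a=s_0<s_1<\dots<s_k=b$, $k\ge1$, such that each restriction $\beta|_{[s_{i-1},s_i]}$ is a future-directed or a past-directed causal curve. Its null length is $\hat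 L_\tau(\beta)=\sum_{i=1}^k|\tau(\beta(s_i))-\tau(\beta(s_{i-1}))|$, and the null distance $\hat d_\tau(p,q)\in[0,\infty]$ is the infimum of $\hat L_\tau(\beta)$ over all piecewise causal paths $\beta$ from $p$ to $q$ (with $\inf\emptyset=\infty$). Let $\tau_1,\tau_2\colon M\to\mathbb{R}$ be two admissible time functions on $(M,g)$. Then for every compact set $K\subseteq M$ there exists a constant $C\ge1$ such that for all $p,q\in K$, $$\tfrac1C\,\hat d_{\tau_1}(p,q)\le \hat d_{\tau_2}(p,q)\le C\,\hat d_{\tau_1}(p,q).$$ -/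

import Mathlib

open Set Manifold MeasureTheory Bundle
open scoped Topology ENNReal ContDiff

noncomputable section

namespace NullDistance

/-- A smooth Lorentzian metric on a manifold `M` modelled on the vector space `E`: a smooth field
of symmetric bilinear forms on the tangent spaces, of signature `(-, +, ..., +)`. -/
structure LorentzianMetric (E : Type*) [NormedAddCommGroup E] [NormedSpace ℝ E]
    (M : Type*) [TopologicalSpace M] [ChartedSpace E M] [IsManifold 𝓘(ℝ, E) ∞ M] where
  /-- The bilinear form on each tangent space. -/
  form (x : M) : TangentSpace 𝓘(ℝ, E) x →L[ℝ] TangentSpace 𝓘(ℝ, E) x →L[ℝ] ℝ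
  symm (x : M) (v w : TangentSpace 𝓘(ℝ, E) x) : form x v w = form x w v
  /-- There is a negative direction whose orthogonal complement is positive definite. -/
  signature (x : M) : ∃ v : TangentSpace 𝓘(ℝ, E) x, form x v v < 0 ∧
    ∀ w : TangentSpace 𝓘(ℝ, E) x, form x v w = 0 → w ≠ 0 → 0 < form x w w
  contMDiff : ContMDiff 𝓘(ℝ, E) (𝓘(ℝ, E).prod 𝓘(ℝ, E →L[ℝ] E →L[ℝ] ℝ)) ∞
    (fun x ↦ TotalSpace.mk' (E →L[ℝ] E →L[ℝ] ℝ)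
      (E := fun x : M ↦ TangentSpace 𝓘(ℝ, E) x →L[ℝ] TangentSpace 𝓘(ℝ, E) x →L[ℝ] ℝ)
      x (form x))

section

variable {E : Type*} [NormedAddCommGroup E] [NormedSpace ℝ E]
  {M : Type*} [TopologicalSpace M] [ChartedSpace E M] [IsManifold 𝓘(ℝ, E) ∞ M]

/-- A time orientation of a Lorentzian manifold, given by a continuous timelike vector field. -/
structure TimeOrientation (g : LorentzianMetric E M) where
  /-- The timelike vector field, declared to be future-directed. -/
  field (x : M) : TangentSpace 𝓘(ℝ, E) x
  timelike (x : M) : g.form x (field x) (field x) < 0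
  continuous : Continuous (fun x ↦ (⟨x, field x⟩ : TangentBundle 𝓘(ℝ, E) M))

variable {g : LorentzianMetric E M}

/-- A tangent vector is future-directed causal if it is nonzero, timelike or null, and lies in the
same half of the causal cone as the time orientation. -/
def TimeOrientation.IsFutureCausal (o : TimeOrientation g) {x : M}
    (v : TangentSpace 𝓘(ℝ, E) x) : Prop :=
  v ≠ 0 ∧ g.form x v v ≤ 0 ∧ g.form x (o.field x) v < 0

/-- A tangent vector is past-directed causal if its negative is future-directed causal. -/
def TimeOrientation.IsPastCausal (o : TimeOrientation g) {x : M}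
    (v : TangentSpace 𝓘(ℝ, E) x) : Prop :=
  o.IsFutureCausal (-v)

variable (E M) in
/-- Smooth Riemannian metrics on `M`. -/
abbrev RiemMetric : Type _ :=
  ContMDiffRiemannianMetric 𝓘(ℝ, E) ∞ E (fun x : M ↦ TangentSpace 𝓘(ℝ, E) x)

/-- The Riemannian distance `d_h` (infinite between points in different components). -/
def riemDist (h : RiemMetric E M) (p q : M) : ℝ≥0∞ :=
  letI : RiemannianBundle (fun x : M ↦ TangentSpace 𝓘(ℝ, E) x) := ⟨h.toRiemannianMetric⟩
  riemannianEDist 𝓘(ℝ, E) p q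

variable (E) in
/-- The path `γ` is locally Lipschitz on `[a, b]` with respect to every Riemannian metric. -/
def IsLocLipschitzPath (γ : ℝ → M) (a b : ℝ) : Prop :=
  ∀ h : RiemMetric E M, ∀ t ∈ Icc a b, ∃ L : ℝ, ∃ u ∈ 𝓝[Icc a b] t, ∀ s ∈ u, ∀ s' ∈ u,
    riemDist h (γ s) (γ s') ≤ ENNReal.ofReal (L * |s - s'|)

/-- The restriction of `γ` to `[a, b]` is a future-directed causal curve: it is locally Lipschitz
and its velocity exists and is future-directed causal at almost every time. -/
def TimeOrientation.IsFutureCausalCurve (o : TimeOrientation g) (γ : ℝ → M) (a b : ℝ) : Prop :=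
  a < b ∧ IsLocLipschitzPath E γ a b ∧
    ∀ᵐ t ∂(volume.restrict (Icc a b)), MDifferentiableAt 𝓘(ℝ, ℝ) 𝓘(ℝ, E) γ t ∧
      o.IsFutureCausal (mfderiv 𝓘(ℝ, ℝ) 𝓘(ℝ, E) γ t (1 : ℝ))

/-- The restriction of `γ` to `[a, b]` is a past-directed causal curve. -/
def TimeOrientation.IsPastCausalCurve (o : TimeOrientation g) (γ : ℝ → M) (a b : ℝ) : Prop :=
  a < b ∧ IsLocLipschitzPath E γ a b ∧
    ∀ᵐ t ∂(volume.restrict (Icc a b)), MDifferentiableAt 𝓘(ℝ, ℝ) 𝓘(ℝ, E) γ t ∧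
      o.IsPastCausal (mfderiv 𝓘(ℝ, ℝ) 𝓘(ℝ, E) γ t (1 : ℝ))

/-- The causal relation `q ∈ J⁺(p)`: there is a future-directed causal curve from `p` to `q`, the
trivial curve at a point being allowed. -/
def TimeOrientation.CausalLE (o : TimeOrientation g) (p q : M) : Prop :=
  p = q ∨ ∃ (γ : ℝ → M) (a b : ℝ), o.IsFutureCausalCurve γ a b ∧ γ a = p ∧ γ b = q

/-- A time function: continuous and strictly increasing along the causal relation. -/
def TimeOrientation.IsTimeFunction (o : TimeOrientation g) (τ : M → ℝ) : Prop :=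
  Continuous τ ∧ ∀ p q : M, o.CausalLE p q → p ≠ q → τ p < τ q

/-- Admissible time functions: time functions which, near each point, are Lipschitz and
anti-Lipschitz on causally related points with respect to a Riemannian metric. Any two Riemannian
distances are locally comparable, so the choice of the metric is irrelevant. -/
def TimeOrientation.IsAdmissible (o : TimeOrientation g) (τ : M → ℝ) : Prop :=
  o.IsTimeFunction τ ∧ ∃ h : RiemMetric E M, ∀ x : M, ∃ U ∈ 𝓝 x, ∃ C : ℝ, 1 ≤ C ∧
    ∀ p ∈ U, ∀ q ∈ U, o.CausalLE p q →
      ENNReal.ofReal (1 / C) * riemDist h p q ≤ ENNReal.ofReal (τ q - τ p) ∧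
      ENNReal.ofReal (τ q - τ p) ≤ ENNReal.ofReal C * riemDist h p q

/-- `β` is a piecewise causal path on `[s 0, s k]` with respect to the partition
`s 0 < s 1 < ... < s k`: on each subinterval it is a future- or past-directed causal curve. -/
def TimeOrientation.IsPiecewiseCausal (o : TimeOrientation g) (β : ℝ → M) (k : ℕ) (s : ℕ → ℝ) :
    Prop :=
  0 < k ∧ ∀ i < k, o.IsFutureCausalCurve β (s i) (s (i + 1)) ∨
    o.IsPastCausalCurve β (s i) (s (i + 1))

/-- The null length of a path with respect to a partition. -/
def nullLength (τ : M → ℝ) (β : ℝ → M) (k : ℕ) (s : ℕ → ℝ) : ℝ :=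
  ∑ i ∈ Finset.range k, |τ (β (s (i + 1))) - τ (β (s i))|

/-- The null distance: the infimum of the null lengths of the piecewise causal paths from `p` to
`q`, taken in `[0, ∞]` (so that it is `∞` if and only if there is no such path). -/
def TimeOrientation.nullDist (o : TimeOrientation g) (τ : M → ℝ) (p q : M) : ℝ≥0∞ :=
  ⨅ (β : ℝ → M) (k : ℕ) (s : ℕ → ℝ)
    (_ : o.IsPiecewiseCausal β k s ∧ β (s 0) = p ∧ β (s k) = q),
    ENNReal.ofReal (nullLength τ β k s)

end

end NullDistance

end

/-! By symmetry it is enough to bound the null distance of `τ₂` on `K` by a multiple of that of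
`τ₁`. In a chart near a point, admissibility says that the variation of each time function between
causally related points is comparable to the chart distance, hence the variations of `τ₁` and `τ₂`
are comparable to each other. A piecewise causal path whose break points all stay near its start
therefore has comparable null lengths, term by term. A path with a distant break point must cross a
coordinate shell, and the anti-Lipschitz bound makes its `τ₁`-length at least some `ε > 0`
(`exists_nullLength_le_or_le`).

For such long paths no comparison of lengths is needed. Whether the null distance is finite depends
only on the existence of a path, and where it is finite on `K × K` it is bounded by some `D`
(`exists_nullDist_le_of_isCompact`), so the `τ₂`-distance is at most `D / ε` times the `τ₁`-length.
The bound `D` comes from local boundedness (`exists_nullDist_le`), the triangle inequality and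
compactness. Nearby points are joined by a two-piece zigzag, because the future cones near a point
share an open set of directions. -/

namespace NullDistance

/-! ### Riemannian distance and chart distance are locally comparable. -/

section Riemannian

open scoped NNReal
open Metric

variable {E : Type*} [NormedAddCommGroup E] [NormedSpace ℝ E]
  {M : Type*} [TopologicalSpace M] [ChartedSpace E M]

section Bundle

variable [RiemannianBundle (fun x : M ↦ TangentSpace 𝓘(ℝ, E) x)]
  [IsManifold 𝓘(ℝ, E) 1 M]
  [IsContinuousRiemannianBundle E (fun x : M ↦ TangentSpace 𝓘(ℝ, E) x)]

/-- The derivative of the chart is locally bounded. -/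
lemma exists_enorm_mfderiv_extChartAt_le (x : M) :
    ∃ C > (0 : ℝ≥0), ∀ᶠ y in 𝓝 x, ∀ v : TangentSpace 𝓘(ℝ, E) y,
      ‖(show E from mfderiv 𝓘(ℝ, E) 𝓘(ℝ, E) (extChartAt 𝓘(ℝ, E) x) y v)‖ₑ ≤ C * ‖v‖ₑ := by
  obtain ⟨C, C_pos, hC⟩ :=
    eventually_norm_trivializationAt_lt E (fun x : M ↦ TangentSpace 𝓘(ℝ, E) x) x
  lift C to ℝ≥0 using C_pos.le
  refine ⟨C, by simpa using C_pos, ?_⟩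
  filter_upwards [hC, chart_source_mem_nhds E x] with y hy h'y v
  rw [← TangentBundle.continuousLinearMapAt_trivializationAt h'y]
  have h := (ContinuousLinearMap.le_opNorm _ v).trans
    (mul_le_mul_of_nonneg_right hy.le (norm_nonneg v))
  simp only [enorm, nnnorm]
  exact_mod_cast h

/-- The derivative of the inverse of the chart is locally bounded. -/
lemma exists_enorm_mfderiv_extChartAt_symm_le (x : M) :
    ∃ C > (0 : ℝ≥0), ∀ᶠ z in 𝓝 (extChartAt 𝓘(ℝ, E) x x), ∀ v : E,
      ‖(mfderiv 𝓘(ℝ, E) 𝓘(ℝ, E) (extChartAt 𝓘(ℝ, E) x).symm z v)‖ₑ ≤ C * ‖v‖ₑ := by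
  obtain ⟨C, C_pos, hC⟩ :=
    eventually_norm_symmL_trivializationAt_lt E (fun x : M ↦ TangentSpace 𝓘(ℝ, E) x) x
  lift C to ℝ≥0 using C_pos.le
  refine ⟨C, by simpa using C_pos, ?_⟩
  have hcont := continuousAt_extChartAt_symm (I := 𝓘(ℝ, E)) x
  rw [ContinuousAt, extChartAt_to_inv] at hcont
  filter_upwards [hcont.eventually hC, extChartAt_target_mem_nhds (I := 𝓘(ℝ, E)) x]
    with z hz hzt v
  have hs : (extChartAt 𝓘(ℝ, E) x).symm z ∈ (chartAt E x).source := by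
    rw [← extChartAt_source 𝓘(ℝ, E)]
    exact (extChartAt 𝓘(ℝ, E) x).map_target hzt
  have h := (ContinuousLinearMap.le_opNorm _ v).trans
    (mul_le_mul_of_nonneg_right hz.le (norm_nonneg v))
  -- Stated for a variable `w`, so that the base point `φ (φ.symm z)` can be replaced by `z` without
  -- transport between tangent spaces.
  have e : ∀ w, w = z →
      (mfderivWithin 𝓘(ℝ, E) 𝓘(ℝ, E) (extChartAt 𝓘(ℝ, E) x).symm (range 𝓘(ℝ, E)) w : E →L[ℝ] E) =
        (mfderiv 𝓘(ℝ, E) 𝓘(ℝ, E) (extChartAt 𝓘(ℝ, E) x).symm z : E →L[ℝ] E) := by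
    rintro _ rfl
    rw [modelWithCornersSelf_coe, range_id, mfderivWithin_univ]
  have e' : ((trivializationAt E (fun x : M ↦ TangentSpace 𝓘(ℝ, E) x) x).symmL ℝ
      ((extChartAt 𝓘(ℝ, E) x).symm z) : E →L[ℝ] E) =
      (mfderiv 𝓘(ℝ, E) 𝓘(ℝ, E) (extChartAt 𝓘(ℝ, E) x).symm z : E →L[ℝ] E) :=
    (TangentBundle.symmL_trivializationAt hs).trans
      (e _ ((extChartAt 𝓘(ℝ, E) x).right_inv hzt))
  have e'' : (trivializationAt E (fun x : M ↦ TangentSpace 𝓘(ℝ, E) x) x).symmL ℝ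
      ((extChartAt 𝓘(ℝ, E) x).symm z) v =
      mfderiv 𝓘(ℝ, E) 𝓘(ℝ, E) (extChartAt 𝓘(ℝ, E) x).symm z v := congrArg (fun L : E →L[ℝ] E ↦ L v) e'
  rw [e''] at h
  simp only [enorm, nnnorm]
  exact_mod_cast h

/-- Near any point, the Riemannian distance is bounded by the distance in the chart. -/
lemma exists_riemannianEDist_le_edist_extChartAt (x : M) :
    ∃ C : ℝ≥0, ∃ U ∈ 𝓝 x, ∀ y ∈ U, ∀ z ∈ U, riemannianEDist 𝓘(ℝ, E) y z ≤
      C * edist (extChartAt 𝓘(ℝ, E) x y) (extChartAt 𝓘(ℝ, E) x z) := by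
  rcases exists_enorm_mfderiv_extChartAt_symm_le (E := E) x with ⟨C, C_pos, hC⟩
  obtain ⟨r, r_pos, hr⟩ := Metric.mem_nhds_iff.1
    (Filter.inter_mem (extChartAt_target_mem_nhds (I := 𝓘(ℝ, E)) x) hC)
  have A : (extChartAt 𝓘(ℝ, E) x) ⁻¹' ball (extChartAt 𝓘(ℝ, E) x x) r ∈ 𝓝 x :=
    (continuousAt_extChartAt x).preimage_mem_nhds (ball_mem_nhds _ r_pos)
  refine ⟨C, _, Filter.inter_mem A (chart_source_mem_nhds E x), ?_⟩
  rintro y ⟨hy, h'y⟩ z ⟨hz, h'z⟩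
  -- The competitor is the straight segment in the chart, whose length there is exactly the chart
  -- distance.
  let η := ContinuousAffineMap.lineMap (R := ℝ) (extChartAt 𝓘(ℝ, E) x y) (extChartAt 𝓘(ℝ, E) x z)
  set γ := (extChartAt 𝓘(ℝ, E) x).symm ∘ η
  have hη : Icc 0 1 ⊆ ⇑η ⁻¹' ((extChartAt 𝓘(ℝ, E) x).target ∩
        {y | ∀ v : E, ‖mfderiv 𝓘(ℝ, E) 𝓘(ℝ, E) (extChartAt 𝓘(ℝ, E) x).symm y v‖ₑ ≤ C * ‖v‖ₑ}) := by
    simp only [← image_subset_iff, ContinuousAffineMap.coe_lineMap_eq,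
     ← segment_eq_image_lineMap, η]
    apply Subset.trans _ hr
    exact (convex_ball _ _).segment_subset hy hz
  simp only [preimage_inter, subset_inter_iff] at hη
  have η_smooth : ContMDiffOn 𝓘(ℝ, ℝ) 𝓘(ℝ, E) 1 η (Icc 0 1) := by
    apply ContMDiff.contMDiffOn
    rw [contMDiff_iff_contDiff]
    exact ContinuousAffineMap.contDiff _
  have : riemannianEDist 𝓘(ℝ, E) y z ≤ pathELength 𝓘(ℝ, E) γ 0 1 := by
    apply riemannianEDist_le_pathELength _ _ _ zero_le_one
    · exact (contMDiffOn_extChartAt_symm x).comp η_smooth hη.1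
    · simp [γ, η, ContinuousAffineMap.coe_lineMap_eq, h'y]
    · simp [γ, η, ContinuousAffineMap.coe_lineMap_eq, h'z]
  apply this.trans
  have hE : edist (extChartAt 𝓘(ℝ, E) x y) (extChartAt 𝓘(ℝ, E) x z) =
      ∫⁻ t in Icc 0 1, ‖fderivWithin ℝ η (Icc 0 1) t 1‖ₑ :=
    lintegral_fderiv_lineMap_eq_edist.symm
  rw [hE, pathELength_eq_lintegral_mfderivWithin_Icc,
    ← lintegral_const_mul' _ _ ENNReal.coe_ne_top]
  apply setLIntegral_mono' measurableSet_Icc (fun t ht ↦ ?_)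
  have hγt : mfderivWithin 𝓘(ℝ, ℝ) 𝓘(ℝ, E) γ (Icc 0 1) t =
      (mfderiv 𝓘(ℝ, E) 𝓘(ℝ, E) (extChartAt 𝓘(ℝ, E) x).symm (η t)) ∘L
        (mfderivWithin 𝓘(ℝ, ℝ) 𝓘(ℝ, E) η (Icc 0 1) t) := by
    apply mfderiv_comp_mfderivWithin
    · exact ((contMDiffOn_extChartAt_symm (n := 1) x).contMDiffAt
        ((isOpen_extChartAt_target x).mem_nhds (hη.1 ht))).mdifferentiableAt one_ne_zero
    · exact η_smooth.mdifferentiableOn one_ne_zero t ht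
    · rw [uniqueMDiffWithinAt_iff_uniqueDiffWithinAt]
      exact uniqueDiffOn_Icc zero_lt_one t ht
  rw [mfderivWithin_eq_fderivWithin] at hγt
  have hγ1 : mfderivWithin 𝓘(ℝ, ℝ) 𝓘(ℝ, E) γ (Icc 0 1) t 1 =
      mfderiv 𝓘(ℝ, E) 𝓘(ℝ, E) (extChartAt 𝓘(ℝ, E) x).symm (η t)
        (fderivWithin ℝ η (Icc 0 1) t 1) := congr($hγt 1)
  rw [hγ1]
  exact hη.2 ht _

/-- Near any point, the distance in the chart is bounded by the Riemannian distance. -/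
lemma exists_edist_extChartAt_le_riemannianEDist [RegularSpace M] (x : M) :
    ∃ C : ℝ≥0, ∃ U ∈ 𝓝 x, ∀ y ∈ U, ∀ z ∈ U,
      edist (extChartAt 𝓘(ℝ, E) x y) (extChartAt 𝓘(ℝ, E) x z) ≤
        C * riemannianEDist 𝓘(ℝ, E) y z := by
  rcases exists_enorm_mfderiv_extChartAt_le (E := E) x with ⟨C, C_pos, hC⟩
  obtain ⟨c, c_pos, hc⟩ := setOfPred_riemannianEDist_lt_subset_nhds 𝓘(ℝ, E)
    (Filter.inter_mem hC (chart_source_mem_nhds E x))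
  -- Points within `c / 4` of `x` are less than `c / 2` apart, and a path of length below `c / 2`
  -- between them stays within `c / 4 + c / 2 ≤ c` of `x`, where the derivative of the chart is
  -- controlled.
  have hc4 : (0 : ℝ≥0∞) < ((c / 4 : ℝ≥0) : ℝ≥0∞) := by
    have : 0 < c / 4 := by positivity
    exact_mod_cast this
  have hsum : ((c / 4 : ℝ≥0) : ℝ≥0∞) + ((c / 2 : ℝ≥0) : ℝ≥0∞) ≤ c := by
    rw [← ENNReal.coe_add]
    have : c / 4 + c / 2 ≤ c := by
      rw [← NNReal.coe_le_coe]; push_cast; linarith [c.2]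
    exact_mod_cast this
  have hsum' : ((c / 4 : ℝ≥0) : ℝ≥0∞) + ((c / 4 : ℝ≥0) : ℝ≥0∞) = ((c / 2 : ℝ≥0) : ℝ≥0∞) := by
    rw [← ENNReal.coe_add]
    congr 1
    rw [← NNReal.coe_inj]; push_cast; ring
  refine ⟨C, _, eventually_riemannianEDist_lt 𝓘(ℝ, E) x hc4, fun y hy z hz ↦ ?_⟩
  simp only [mem_ofPred_eq] at hy hz
  have hyz : riemannianEDist 𝓘(ℝ, E) y z < ((c / 2 : ℝ≥0) : ℝ≥0∞) :=
    riemannianEDist_triangle.trans_lt (by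
      rw [riemannianEDist_comm, ← hsum']; exact ENNReal.add_lt_add hy hz)
  -- The distance is an infimum of lengths, and only lengths below `c / 2` matter in approaching it.
  suffices H : ∀ r : ℝ≥0∞, riemannianEDist 𝓘(ℝ, E) y z < r → r ≤ ((c / 2 : ℝ≥0) : ℝ≥0∞) →
      edist (extChartAt 𝓘(ℝ, E) x y) (extChartAt 𝓘(ℝ, E) x z) ≤ C * r by
    have hC0 : (C : ℝ≥0∞) ≠ 0 := by exact_mod_cast C_pos.ne'
    rw [mul_comm, ← ENNReal.div_le_iff hC0 ENNReal.coe_ne_top]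
    refine le_of_forall_gt fun r hr ↦ ?_
    obtain ⟨r', h1, h2⟩ := exists_between (lt_min hr hyz)
    have := H r' h1 (h2.le.trans (min_le_right _ _))
    rw [mul_comm, ← ENNReal.div_le_iff hC0 ENNReal.coe_ne_top] at this
    exact this.trans_lt (h2.trans_le (min_le_left _ _))
  intro r hr hrc
  rcases exists_lt_locally_constant_of_riemannianEDist_lt hr zero_lt_one
    with ⟨γ, hγy, hγz, γ_smooth, hγ, -⟩
  have hin : ∀ t ∈ Icc (0 : ℝ) 1, γ t ∈
      {y | ∀ v : TangentSpace 𝓘(ℝ, E) y,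
        ‖(show E from mfderiv 𝓘(ℝ, E) 𝓘(ℝ, E) (extChartAt 𝓘(ℝ, E) x) y v)‖ₑ ≤ C * ‖v‖ₑ} ∩
        (chartAt E x).source := by
    intro t ht
    apply hc
    have h1 : riemannianEDist 𝓘(ℝ, E) y (γ t) ≤ pathELength 𝓘(ℝ, E) γ 0 t :=
      riemannianEDist_le_pathELength γ_smooth.contMDiffOn hγy rfl ht.1
    have h2 : pathELength 𝓘(ℝ, E) γ 0 t ≤ pathELength 𝓘(ℝ, E) γ 0 1 :=
      pathELength_mono le_rfl ht.2
    exact (riemannianEDist_triangle.trans_lt (ENNReal.add_lt_add hy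
      ((h1.trans h2).trans_lt (hγ.trans_le hrc)))).trans_le hsum
  let γ' := extChartAt 𝓘(ℝ, E) x ∘ γ
  have hC' : ContMDiffOn 𝓘(ℝ, ℝ) 𝓘(ℝ, E) 1 γ' (Icc 0 1) :=
    contMDiffOn_extChartAt.comp (I' := 𝓘(ℝ, E)) (t := (chartAt E x).source)
      γ_smooth.contMDiffOn (fun t' ht' ↦ (hin t' ht').2)
  calc
    edist (extChartAt 𝓘(ℝ, E) x y) (extChartAt 𝓘(ℝ, E) x z) = ‖γ' 1 - γ' 0‖ₑ := by
      rw [edist_comm, edist_eq_enorm_sub]; simp [γ', hγy, hγz]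
    _ ≤ ∫⁻ t' in Icc 0 1, ‖derivWithin γ' (Icc 0 1) t'‖ₑ := by
      apply enorm_sub_le_lintegral_derivWithin_Icc_of_contDiffOn_Icc _ zero_le_one
      rwa [← contMDiffOn_iff_contDiffOn]
    _ ≤ ∫⁻ t' in Icc 0 1, C * ‖mfderivWithin 𝓘(ℝ, ℝ) 𝓘(ℝ, E) γ (Icc 0 1) t' 1‖ₑ := by
      apply setLIntegral_mono' measurableSet_Icc (fun t' ht' ↦ ?_)
      have hγt : mfderivWithin 𝓘(ℝ, ℝ) 𝓘(ℝ, E) γ' (Icc 0 1) t' =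
          (mfderiv 𝓘(ℝ, E) 𝓘(ℝ, E) (extChartAt 𝓘(ℝ, E) x) (γ t')) ∘L
            (mfderivWithin 𝓘(ℝ, ℝ) 𝓘(ℝ, E) γ (Icc 0 1) t') := by
        apply mfderiv_comp_mfderivWithin
        · exact mdifferentiableAt_extChartAt (hin t' ht').2
        · exact (γ_smooth.mdifferentiable one_ne_zero).mdifferentiableOn _ ht'
        · rw [uniqueMDiffWithinAt_iff_uniqueDiffWithinAt]
          exact uniqueDiffOn_Icc zero_lt_one _ ht'
      rw [mfderivWithin_eq_fderivWithin] at hγt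
      have hγ1 : derivWithin γ' (Icc 0 1) t' =
          (show E from mfderiv 𝓘(ℝ, E) 𝓘(ℝ, E) (extChartAt 𝓘(ℝ, E) x) (γ t')
            (mfderivWithin 𝓘(ℝ, ℝ) 𝓘(ℝ, E) γ (Icc 0 1) t' 1)) := by
        rw [← fderivWithin_derivWithin]
        exact congr($hγt 1)
      rw [hγ1]
      exact (hin t' ht').1 _
    _ = C * pathELength 𝓘(ℝ, E) γ 0 1 := by
      rw [lintegral_const_mul' _ _ ENNReal.coe_ne_top,
          pathELength_eq_lintegral_mfderivWithin_Icc]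
    _ ≤ C * r := by
      gcongr

end Bundle

variable [IsManifold 𝓘(ℝ, E) ∞ M]

/-- Near any point, the distance of a Riemannian metric is bounded by the distance in the chart. -/
lemma exists_riemDist_le_edist_extChartAt (h : RiemMetric E M) (x : M) :
    ∃ C : ℝ≥0, ∃ U ∈ 𝓝 x, ∀ y ∈ U, ∀ z ∈ U, riemDist h y z ≤
      C * edist (extChartAt 𝓘(ℝ, E) x y) (extChartAt 𝓘(ℝ, E) x z) := by
  let : RiemannianBundle (fun x : M ↦ TangentSpace 𝓘(ℝ, E) x) := ⟨h.toRiemannianMetric⟩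
  have : IsManifold 𝓘(ℝ, E) 1 M := .of_le (n := ∞) (by norm_num)
  have : IsContinuousRiemannianBundle E (fun x : M ↦ TangentSpace 𝓘(ℝ, E) x) :=
    ⟨h.inner, h.contMDiff.continuous, fun _ _ _ ↦ rfl⟩
  exact exists_riemannianEDist_le_edist_extChartAt x

/-- Near any point, the distance in the chart is bounded by the distance of a Riemannian metric. -/
lemma exists_edist_extChartAt_le_riemDist [RegularSpace M] (h : RiemMetric E M) (x : M) :
    ∃ C : ℝ≥0, ∃ U ∈ 𝓝 x, ∀ y ∈ U, ∀ z ∈ U,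
      edist (extChartAt 𝓘(ℝ, E) x y) (extChartAt 𝓘(ℝ, E) x z) ≤ C * riemDist h y z := by
  let : RiemannianBundle (fun x : M ↦ TangentSpace 𝓘(ℝ, E) x) := ⟨h.toRiemannianMetric⟩
  have : IsManifold 𝓘(ℝ, E) 1 M := .of_le (n := ∞) (by norm_num)
  have : IsContinuousRiemannianBundle E (fun x : M ↦ TangentSpace 𝓘(ℝ, E) x) :=
    ⟨h.inner, h.contMDiff.continuous, fun _ _ _ ↦ rfl⟩
  exact exists_edist_extChartAt_le_riemannianEDist x

/-- Every neighborhood of `x` contains a ball for the distance of a Riemannian metric. -/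
lemma exists_riemDist_lt_subset [RegularSpace M] (h : RiemMetric E M) {x : M} {s : Set M}
    (hs : s ∈ 𝓝 x) : ∃ c > 0, ∀ y, riemDist h x y < c → y ∈ s := by
  let : RiemannianBundle (fun x : M ↦ TangentSpace 𝓘(ℝ, E) x) := ⟨h.toRiemannianMetric⟩
  have : IsManifold 𝓘(ℝ, E) 1 M := .of_le (n := ∞) (by norm_num)
  have : IsContinuousRiemannianBundle E (fun x : M ↦ TangentSpace 𝓘(ℝ, E) x) :=
    ⟨h.inner, h.contMDiff.continuous, fun _ _ _ ↦ rfl⟩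
  obtain ⟨c, hc, H⟩ := setOfPred_riemannianEDist_lt_subset_nhds' 𝓘(ℝ, E) hs
  exact ⟨c, hc, fun y hy ↦ H hy⟩

end Riemannian

/-! ### Operations on causal curves, and the triangle inequality. -/

section Curves

variable {E : Type*} [NormedAddCommGroup E] [NormedSpace ℝ E]
  {M : Type*} [TopologicalSpace M] [ChartedSpace E M] [IsManifold 𝓘(ℝ, E) ∞ M]

lemma IsLocLipschitzPath.congr {γ γ' : ℝ → M} {a b : ℝ} (hγ : IsLocLipschitzPath E γ a b)
    (h : EqOn γ γ' (Icc a b)) : IsLocLipschitzPath E γ' a b := by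
  intro g t ht
  obtain ⟨L, u, hu, H⟩ := hγ g t ht
  refine ⟨L, u ∩ Icc a b, Filter.inter_mem hu self_mem_nhdsWithin, fun s hs s' hs' ↦ ?_⟩
  rw [← h hs.2, ← h hs'.2]
  exact H s hs.1 s' hs'.1

lemma IsLocLipschitzPath.mono {γ : ℝ → M} {a b a' b' : ℝ} (hγ : IsLocLipschitzPath E γ a b)
    (ha : a ≤ a') (hb : b' ≤ b) : IsLocLipschitzPath E γ a' b' := by
  intro g t ht
  obtain ⟨L, u, hu, H⟩ := hγ g t (Icc_subset_Icc ha hb ht)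
  exact ⟨L, u, nhdsWithin_mono _ (Icc_subset_Icc ha hb) hu, H⟩

lemma IsLocLipschitzPath.comp_sub_left {γ : ℝ → M} {a b : ℝ} (hγ : IsLocLipschitzPath E γ a b)
    (c : ℝ) : IsLocLipschitzPath E (fun t ↦ γ (c - t)) (c - b) (c - a) := by
  intro g t ht
  obtain ⟨L, u, hu, H⟩ := hγ g (c - t) ⟨by linarith [ht.2], by linarith [ht.1]⟩
  refine ⟨L, (fun t ↦ c - t) ⁻¹' u, ?_, fun s hs s' hs' ↦ ?_⟩
  · have : ContinuousWithinAt (fun t : ℝ ↦ c - t) (Icc (c - b) (c - a)) t := by fun_prop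
    refine this.preimage_mem_nhdsWithin' (nhdsWithin_mono _ ?_ hu)
    rintro _ ⟨s, hs, rfl⟩
    exact ⟨by linarith [hs.2], by linarith [hs.1]⟩
  · have := H _ hs _ hs'
    rwa [show |c - s - (c - s')| = |s - s'| by rw [← abs_neg]; congr 1; ring] at this

/-- Small Riemannian balls lie in any given neighborhood. A metric `h` has to be supplied, since
`IsLocLipschitzPath` quantifies over all metrics and is vacuous if there are none. -/
lemma IsLocLipschitzPath.continuousOn [RegularSpace M] {γ : ℝ → M} {a b : ℝ}
    (hγ : IsLocLipschitzPath E γ a b) (h : RiemMetric E M) : ContinuousOn γ (Icc a b) := by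
  intro t ht s hs
  obtain ⟨c, hc, H⟩ := exists_riemDist_lt_subset h hs
  obtain ⟨L, u, hu, HL⟩ := hγ h t ht
  have h1 : Filter.Tendsto (fun s ↦ ENNReal.ofReal (L * |t - s|)) (𝓝[Icc a b] t) (𝓝 0) := by
    have : Continuous (fun s ↦ ENNReal.ofReal (L * |t - s|)) :=
      ENNReal.continuous_ofReal.comp (by fun_prop)
    simpa using (this.tendsto t).mono_left nhdsWithin_le_nhds
  rw [Filter.mem_map]
  filter_upwards [hu, h1.eventually_lt_const hc] with s hs hs'
  exact H _ ((HL t (mem_of_mem_nhdsWithin ht hu) s hs).trans_lt hs')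

/-- Locally Lipschitz curves whose velocity satisfies `P` almost everywhere. -/
def IsCurveWith (P : ∀ x : M, TangentSpace 𝓘(ℝ, E) x → Prop) (γ : ℝ → M) (a b : ℝ) : Prop :=
  a < b ∧ IsLocLipschitzPath E γ a b ∧
    ∀ᵐ t ∂(volume.restrict (Icc a b)), MDifferentiableAt 𝓘(ℝ, ℝ) 𝓘(ℝ, E) γ t ∧
      P (γ t) (mfderiv 𝓘(ℝ, ℝ) 𝓘(ℝ, E) γ t (1 : ℝ))

variable {P Q : ∀ x : M, TangentSpace 𝓘(ℝ, E) x → Prop} {γ γ' : ℝ → M} {a b : ℝ}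

lemma IsCurveWith.congr (hγ : IsCurveWith P γ a b) (h : EqOn γ γ' (Icc a b)) :
    IsCurveWith P γ' a b := by
  refine ⟨hγ.1, hγ.2.1.congr h, ?_⟩
  have H := hγ.2.2
  -- `mfderiv` is two-sided while the curves agree only on `[a, b]`. The endpoints form a null set
  -- and can be dropped.
  rw [← restrict_Ioo_eq_restrict_Icc, ae_restrict_iff' measurableSet_Ioo] at H ⊢
  filter_upwards [H] with t H ht
  obtain ⟨h1, h2⟩ := H ht
  have e : γ =ᶠ[𝓝 t] γ' := by
    filter_upwards [Ioo_mem_nhds ht.1 ht.2] with s hs using h (Ioo_subset_Icc_self hs)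
  refine ⟨h1.congr_of_eventuallyEq e.symm, ?_⟩
  have key : ∀ (x : M), x = γ t →
      P x ((mfderiv 𝓘(ℝ, ℝ) 𝓘(ℝ, E) γ t : ℝ →L[ℝ] E) (1 : ℝ) : E) := by
    rintro x rfl; exact h2
  have h3 := key (γ' t) (h (Ioo_subset_Icc_self ht)).symm
  have h4 : (mfderiv 𝓘(ℝ, ℝ) 𝓘(ℝ, E) γ t : ℝ →L[ℝ] E) =
    (mfderiv 𝓘(ℝ, ℝ) 𝓘(ℝ, E) γ' t : ℝ →L[ℝ] E) := e.mfderiv_eq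
  rw [h4] at h3
  exact h3

lemma IsCurveWith.mono (hγ : IsCurveWith P γ a b) {a' b' : ℝ} (hab : a' < b') (ha : a ≤ a')
    (hb : b' ≤ b) : IsCurveWith P γ a' b' :=
  ⟨hab, hγ.2.1.mono ha hb, ae_restrict_of_ae_restrict_of_subset (Icc_subset_Icc ha hb) hγ.2.2⟩

lemma IsCurveWith.comp_sub_left (hγ : IsCurveWith P γ a b) (c : ℝ)
    (hPQ : ∀ x v, P x v → Q x (-v)) :
    IsCurveWith Q (fun t ↦ γ (c - t)) (c - b) (c - a) := by
  refine ⟨by linarith [hγ.1], hγ.2.1.comp_sub_left c, ?_⟩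
  have H := hγ.2.2
  rw [ae_restrict_iff' measurableSet_Icc] at H ⊢
  filter_upwards [(Measure.measurePreserving_sub_left volume c).quasiMeasurePreserving.ae H]
    with t H ht
  obtain ⟨h1, h2⟩ := H ⟨by linarith [ht.2], by linarith [ht.1]⟩
  have hd : HasMFDerivAt 𝓘(ℝ, ℝ) 𝓘(ℝ, ℝ) (fun t : ℝ ↦ c - t) t
      (ContinuousLinearMap.toSpanSingleton ℝ (-1 : ℝ)) :=
    ((hasDerivAt_id t).const_sub c).hasFDerivAt.hasMFDerivAt
  have hcomp := HasMFDerivAt.comp t h1.hasMFDerivAt hd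
  refine ⟨hcomp.mdifferentiableAt, ?_⟩
  have h3 := hPQ _ _ h2
  have h4 : (mfderiv 𝓘(ℝ, ℝ) 𝓘(ℝ, E) (fun t ↦ γ (c - t)) t : ℝ →L[ℝ] E) (1 : ℝ) =
      -(mfderiv 𝓘(ℝ, ℝ) 𝓘(ℝ, E) γ (c - t) : ℝ →L[ℝ] E) (1 : ℝ) := by
    have h5 : (mfderiv 𝓘(ℝ, ℝ) 𝓘(ℝ, E) (fun t ↦ γ (c - t)) t : ℝ →L[ℝ] E) =
      (mfderiv 𝓘(ℝ, ℝ) 𝓘(ℝ, E) γ (c - t) : ℝ →L[ℝ] E).comp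
        (ContinuousLinearMap.toSpanSingleton ℝ (-1 : ℝ)) := hcomp.mfderiv
    have h6 : ∀ L : ℝ →L[ℝ] E, L.comp (ContinuousLinearMap.toSpanSingleton ℝ (-1 : ℝ)) (1 : ℝ) =
        -L 1 := fun L ↦ by simp
    rw [h5]
    exact h6 _
  exact h4 ▸ h3

/-- A translation is a composite of two reflections of the time axis, and the velocity changes sign
twice. -/
lemma IsCurveWith.comp_add_right (hγ : IsCurveWith P γ a b) (c : ℝ) :
    IsCurveWith P (fun t ↦ γ (t + c)) (a - c) (b - c) := by
  have h := (hγ.comp_sub_left (Q := fun x v ↦ P x (-v)) 0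
    (fun x v h ↦ by simpa using h)).comp_sub_left (Q := P) (-c) (fun _ _ h ↦ h)
  have e : (fun t ↦ γ (0 - (-c - t))) = fun t ↦ γ (t + c) := by
    ext t; congr 1; ring
  have e1 : -c - (0 - a) = a - c := by ring
  have e2 : -c - (0 - b) = b - c := by ring
  rwa [e, e1, e2] at h

variable {g : LorentzianMetric E M} {o : TimeOrientation g}

/-- Both kinds of causal curve are instances of `IsCurveWith` by definition, so they share its
closure properties, and time reversal exchanges them. -/
lemma TimeOrientation.isPastCausalCurve_iff :
    o.IsPastCausalCurve γ a b ↔ IsCurveWith (fun _ v ↦ o.IsPastCausal v) γ a b := Iff.rfl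

/-- The endpoints of a causal curve are causally related. -/
lemma TimeOrientation.causalLE_or_causalLE
    (h : o.IsFutureCausalCurve γ a b ∨ o.IsPastCausalCurve γ a b) :
    o.CausalLE (γ a) (γ b) ∨ o.CausalLE (γ b) (γ a) := by
  rcases h with h | h
  · exact .inl (.inr ⟨γ, a, b, h, rfl, rfl⟩)
  · refine .inr (.inr ⟨fun t ↦ γ (0 - t), 0 - b, 0 - a, ?_, by simp, by simp⟩)
    exact IsCurveWith.comp_sub_left (o.isPastCausalCurve_iff.1 h) 0 (fun _ _ h ↦ h)

lemma TimeOrientation.nullDist_le (τ : M → ℝ) {β : ℝ → M} {k : ℕ} {s : ℕ → ℝ}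
    (h : o.IsPiecewiseCausal β k s) :
    o.nullDist τ (β (s 0)) (β (s k)) ≤ ENNReal.ofReal (nullLength τ β k s) :=
  iInf_le_of_le β (iInf_le_of_le k (iInf_le_of_le s (iInf_le _ ⟨h, rfl, rfl⟩)))

lemma TimeOrientation.exists_of_nullDist_lt {τ : M → ℝ} {p q : M} {r : ℝ≥0∞}
    (h : o.nullDist τ p q < r) : ∃ (β : ℝ → M) (k : ℕ) (s : ℕ → ℝ),
      o.IsPiecewiseCausal β k s ∧ β (s 0) = p ∧ β (s k) = q ∧
      ENNReal.ofReal (nullLength τ β k s) < r := by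
  simp only [nullDist, iInf_lt_iff] at h
  obtain ⟨β, k, s, ⟨h1, h2, h3⟩, h4⟩ := h
  exact ⟨β, k, s, h1, h2, h3, h4⟩

lemma nullLength_nonneg {X : Type*} (τ : X → ℝ) (β : ℝ → X) (k : ℕ) (s : ℕ → ℝ) : 0 ≤ nullLength τ β k s :=
  Finset.sum_nonneg fun _ _ ↦ abs_nonneg _

/-- Finiteness of the null distance does not depend on the time function. -/
lemma TimeOrientation.nullDist_lt_top_of_isPiecewiseCausal (τ : M → ℝ) {β : ℝ → M} {k : ℕ}
    {s : ℕ → ℝ} (h : o.IsPiecewiseCausal β k s) : o.nullDist τ (β (s 0)) (β (s k)) < ⊤ :=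
  (o.nullDist_le τ h).trans_lt ENNReal.ofReal_lt_top

/-- Concatenation of piecewise causal paths. -/
lemma TimeOrientation.IsPiecewiseCausal.exists_concat {β₁ β₂ : ℝ → M} {k₁ k₂ : ℕ} {s₁ s₂ : ℕ → ℝ}
    (h₁ : o.IsPiecewiseCausal β₁ k₁ s₁) (h₂ : o.IsPiecewiseCausal β₂ k₂ s₂)
    (h : β₁ (s₁ k₁) = β₂ (s₂ 0)) (τ : M → ℝ) :
    ∃ (β : ℝ → M) (k : ℕ) (s : ℕ → ℝ), o.IsPiecewiseCausal β k s ∧ β (s 0) = β₁ (s₁ 0) ∧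
      β (s k) = β₂ (s₂ k₂) ∧ nullLength τ β k s = nullLength τ β₁ k₁ s₁ + nullLength τ β₂ k₂ s₂ := by
  -- The shift makes the second path start when the first one ends. At the junction both formulas
  -- for `β` and for `s` agree.
  set c := s₂ 0 - s₁ k₁ with hc
  set β : ℝ → M := fun t ↦ if t ≤ s₁ k₁ then β₁ t else β₂ (t + c) with hβ
  set s : ℕ → ℝ := fun i ↦ if i ≤ k₁ then s₁ i else s₂ (i - k₁) - c with hs
  -- The order of the partition is contained in the condition `a < b` on each causal piece.
  have lt₁ : ∀ i < k₁, s₁ i < s₁ (i + 1) := fun i hi ↦ (h₁.2 i hi).elim (·.1) (·.1)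
  have lt₂ : ∀ i < k₂, s₂ i < s₂ (i + 1) := fun i hi ↦ (h₂.2 i hi).elim (·.1) (·.1)
  have le₁ : ∀ i ≤ k₁, s₁ i ≤ s₁ k₁ := by
    intro i hi
    induction hi using Nat.decreasingInduction with
    | self => exact le_rfl
    | of_succ i hi ih => exact (lt₁ i hi).le.trans ih
  have le₂ : ∀ i ≤ k₂, s₂ 0 ≤ s₂ i := by
    intro i
    induction i with
    | zero => intro _; exact le_rfl
    | succ i ih => intro hi; exact (ih (by omega)).trans (lt₂ i hi).le
  have sl : ∀ i ≤ k₁, s i = s₁ i := fun i hi ↦ by simp [hs, hi]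
  have sr : ∀ i, s (k₁ + i) = s₂ i - c := by
    intro i
    rcases Nat.eq_zero_or_pos i with rfl | hi
    · simp [hs, hc]
    · simp [hs, hi.ne']
  have βl : ∀ t ≤ s₁ k₁, β t = β₁ t := fun t ht ↦ by simp [hβ, ht]
  have βr : ∀ t, s₁ k₁ ≤ t → β t = β₂ (t + c) := by
    intro t ht
    rcases ht.eq_or_lt with rfl | ht
    · rw [βl _ le_rfl, h, hc]; congr 1; ring
    · simp [hβ, ht]
  have vl : ∀ i ≤ k₁, β (s i) = β₁ (s₁ i) := fun i hi ↦ by rw [sl i hi, βl _ (le₁ i hi)]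
  have vr : ∀ i ≤ k₂, β (s (k₁ + i)) = β₂ (s₂ i) := fun i hi ↦ by
    rw [sr, βr _ (by rw [hc]; linarith [le₂ i hi])]; congr 1; ring
  refine ⟨β, k₁ + k₂, s, ⟨by have := h₁.1; omega, fun i hi ↦ ?_⟩, vl 0 (Nat.zero_le _),
    vr k₂ le_rfl, ?_⟩
  · rcases lt_or_ge i k₁ with hik | hik
    · rw [sl i hik.le, sl (i + 1) hik]
      have e : EqOn β₁ β (Icc (s₁ i) (s₁ (i + 1))) := fun t ht ↦
        (βl t (ht.2.trans (le₁ _ hik))).symm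
      exact (h₁.2 i hik).imp (fun h ↦ IsCurveWith.congr h e) (fun h ↦ IsCurveWith.congr h e)
    · obtain ⟨j, rfl⟩ := Nat.exists_eq_add_of_le hik
      have hj : j < k₂ := by omega
      rw [sr, add_assoc, sr]
      have e : EqOn (fun t ↦ β₂ (t + c)) β (Icc (s₂ j - c) (s₂ (j + 1) - c)) := fun t ht ↦
        (βr t (by have := ht.1; rw [hc] at this; linarith [le₂ j hj.le])).symm
      exact (h₂.2 j hj).imp (fun h ↦ (IsCurveWith.comp_add_right h c).congr e)
        (fun h ↦ (IsCurveWith.comp_add_right h c).congr e)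
  · unfold nullLength
    rw [Finset.sum_range_add]
    congr 1
    · refine Finset.sum_congr rfl fun i hi ↦ ?_
      have hi := Finset.mem_range.1 hi
      rw [vl i hi.le, vl (i + 1) hi]
    · refine Finset.sum_congr rfl fun i hi ↦ ?_
      have hi := Finset.mem_range.1 hi
      rw [vr i hi.le, add_assoc, vr (i + 1) hi]

/-- Near-optimal paths can be concatenated, and null length is additive. -/
lemma TimeOrientation.nullDist_triangle (τ : M → ℝ) (p q r : M) :
    o.nullDist τ p r ≤ o.nullDist τ p q + o.nullDist τ q r := by
  refine le_of_forall_gt fun u hu ↦ ?_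
  obtain ⟨u₁, h₁, u₂, h₂, hu'⟩ := ENNReal.exists_add_lt_of_add_lt hu
  obtain ⟨β₁, k₁, s₁, hβ₁, hp, hq, hl₁⟩ := o.exists_of_nullDist_lt h₁
  obtain ⟨β₂, k₂, s₂, hβ₂, hq', hr, hl₂⟩ := o.exists_of_nullDist_lt h₂
  obtain ⟨β, k, s, hβ, e₁, e₂, hl⟩ := hβ₁.exists_concat hβ₂ (hq.trans hq'.symm) τ
  have := o.nullDist_le τ hβ
  rw [e₁, e₂, hp, hr, hl, ENNReal.ofReal_add (nullLength_nonneg ..) (nullLength_nonneg ..)] at this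
  exact this.trans_lt ((ENNReal.add_lt_add hl₁ hl₂).trans hu')

end Curves

/-! ### Local causality in charts: the null distance is locally bounded. -/

section LocalCausality

open Metric

variable {E : Type*} [NormedAddCommGroup E] [NormedSpace ℝ E]
  {M : Type*} [TopologicalSpace M] [ChartedSpace E M] [IsManifold 𝓘(ℝ, E) ∞ M]

/-- A `C¹` curve is locally Lipschitz in a chart, and the chart distance dominates the Riemannian
one. -/
lemma isLocLipschitzPath_of_contMDiffAt {γ : ℝ → M} {a b : ℝ}
    (hγ : ∀ t ∈ Icc a b, ContMDiffAt 𝓘(ℝ, ℝ) 𝓘(ℝ, E) 1 γ t) : IsLocLipschitzPath E γ a b := by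
  intro h t ht
  have : IsManifold 𝓘(ℝ, E) 1 M := .of_le (n := ∞) (by norm_num)
  obtain ⟨C, U, hU, HU⟩ := exists_riemDist_le_edist_extChartAt h (γ t)
  have hd : ContDiffAt ℝ 1 (extChartAt 𝓘(ℝ, E) (γ t) ∘ γ) t :=
    contMDiffAt_iff_contDiffAt.1 ((contMDiffAt_extChartAt (x := γ t)).comp t (hγ t ht))
  obtain ⟨K, V, hV, HV⟩ := hd.exists_lipschitzOnWith
  refine ⟨C * K, V ∩ γ ⁻¹' U, mem_nhdsWithin_of_mem_nhds
    (Filter.inter_mem hV ((hγ t ht).continuousAt.preimage_mem_nhds hU)), fun s hs s' hs' ↦ ?_⟩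
  calc riemDist h (γ s) (γ s')
      ≤ C * edist (extChartAt 𝓘(ℝ, E) (γ t) (γ s)) (extChartAt 𝓘(ℝ, E) (γ t) (γ s')) :=
        HU _ hs.2 _ hs'.2
    _ ≤ C * (K * edist s s') := by gcongr; exact HV hs.1 hs'.1
    _ = ENNReal.ofReal (C * K * |s - s'|) := by
        rw [edist_dist, Real.dist_eq, ENNReal.ofReal_mul (by positivity),
          ENNReal.ofReal_mul (by positivity), ENNReal.ofReal_coe_nnreal,
          ENNReal.ofReal_coe_nnreal, mul_assoc]

/-- The bilinear form of a Lorentzian metric depends continuously on its arguments. -/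
lemma LorentzianMetric.continuousAt_form (g : LorentzianMetric E M) {X : Type*}
    [TopologicalSpace X] {b : X → M} {v w : ∀ x, TangentSpace 𝓘(ℝ, E) (b x)} {x : X}
    (hv : ContinuousAt (fun m ↦ (⟨b m, v m⟩ : TangentBundle 𝓘(ℝ, E) M)) x)
    (hw : ContinuousAt (fun m ↦ (⟨b m, w m⟩ : TangentBundle 𝓘(ℝ, E) M)) x) :
    ContinuousAt (fun m ↦ g.form (b m) (v m) (w m)) x := by
  have hb : ContinuousAt b x := (FiberBundle.continuousAt_totalSpace E _).1 hv |>.1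
  have : ContinuousAt
      (fun m ↦ TotalSpace.mk' ℝ (E := Bundle.Trivial M ℝ) (b m) (g.form (b m) (v m) (w m))) x :=
    ((g.contMDiff.continuous.continuousAt (x := b x)).comp hb).clm_bundle_apply₂
      (F₁ := E) (F₂ := E) hv hw
  exact ((FiberBundle.continuousAt_totalSpace ℝ _).1 this).2

variable {g : LorentzianMetric E M} {o : TimeOrientation g}

/-- In a chart, the future cones near a point contain a common open set of directions. -/
lemma TimeOrientation.exists_isFutureCausal_mfderiv_extChartAt_symm (o : TimeOrientation g)
    (x : M) : ∃ T : E, ∃ δ > 0, ∃ r > 0, ∀ y ∈ ball (extChartAt 𝓘(ℝ, E) x x) r, ∀ v ∈ ball T δ,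
      y ∈ (extChartAt 𝓘(ℝ, E) x).target ∧
      o.IsFutureCausal (mfderiv 𝓘(ℝ, E) 𝓘(ℝ, E) (extChartAt 𝓘(ℝ, E) x).symm y v) := by
  have : IsManifold 𝓘(ℝ, E) 1 M := .of_le (n := ∞) (by norm_num)
  set φ := extChartAt 𝓘(ℝ, E) x with hφ
  have ho : IsOpen φ.target := isOpen_extChartAt_target x
  have hx : φ x ∈ φ.target := mem_extChartAt_target x
  obtain ⟨e, he⟩ := isInvertible_mfderivWithin_extChartAt_symm (I := 𝓘(ℝ, E)) hx
  rw [modelWithCornersSelf_coe, range_id, mfderivWithin_univ] at he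
  obtain ⟨T, hT⟩ : ∃ T : E, mfderiv 𝓘(ℝ, E) 𝓘(ℝ, E) φ.symm (φ x) T = o.field (φ.symm (φ x)) := by
    obtain ⟨T, hT⟩ := e.surjective (o.field (φ.symm (φ x)))
    exact ⟨T, by rw [← hT, ← he]; rfl⟩
  let V : ∀ m : E × E, TangentSpace 𝓘(ℝ, E) (φ.symm m.1) := fun m ↦
    mfderiv 𝓘(ℝ, E) 𝓘(ℝ, E) φ.symm m.1 m.2
  have hV : ContinuousAt (fun m ↦ (⟨φ.symm m.1, V m⟩ : TangentBundle 𝓘(ℝ, E) M)) (φ x, T) := by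
    have h1 := (contMDiffOn_extChartAt_symm (I := 𝓘(ℝ, E)) (n := 1) x).continuousOn_tangentMapWithin
      le_rfl ho.uniqueMDiffOn
    have h2 : Continuous (fun m : E × E ↦ (⟨m.1, m.2⟩ : TangentBundle 𝓘(ℝ, E) E)) :=
      (tangentBundleModelSpaceHomeomorph 𝓘(ℝ, E)).symm.continuous
    have h3 : (π E (TangentSpace 𝓘(ℝ, E) : E → Type _)) ⁻¹' φ.target ∈
        𝓝 (⟨φ x, T⟩ : TangentBundle 𝓘(ℝ, E) E) :=
      (ho.preimage (FiberBundle.continuous_proj E _)).mem_nhds hx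
    have h4 := (h1.continuousAt h3).comp_of_eq (h2.continuousAt (x := (φ x, T))) rfl
    refine h4.congr ?_
    filter_upwards [(ho.preimage continuous_fst).mem_nhds (show (φ x, T).1 ∈ φ.target from hx)]
      with m hm
    exact congrArg (fun L : E →L[ℝ] E ↦ (⟨φ.symm m.1, L m.2⟩ : TangentBundle 𝓘(ℝ, E) M))
      (mfderivWithin_of_isOpen ho hm)
  have hb : ContinuousAt (fun m : E × E ↦ φ.symm m.1) (φ x, T) :=
    ((FiberBundle.continuousAt_totalSpace E _).1 hV).1
  have hF : ContinuousAt (fun m : E × E ↦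
      (⟨φ.symm m.1, o.field (φ.symm m.1)⟩ : TangentBundle 𝓘(ℝ, E) M)) (φ x, T) :=
    (o.continuous.continuousAt (x := φ.symm (φ x))).comp (f := fun m : E × E ↦ φ.symm m.1) hb
  have hneg := o.timelike (φ.symm (φ x))
  -- The vector `T` represents the time orientation, so both inequalities are strict at `(φ x, T)`
  -- and persist nearby. Strictness in the first also forces the vectors to be nonzero.
  have e1 := (g.continuousAt_form hV hV).eventually_lt_const (u := 0)
    (by simp only [V]; rw [hT]; exact hneg)
  have e2 := (g.continuousAt_form hF hV).eventually_lt_const (u := 0)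
    (by simp only [V]; rw [hT]; exact hneg)
  have e3 : ∀ᶠ m : E × E in 𝓝 (φ x, T), m.1 ∈ φ.target :=
    (ho.preimage continuous_fst).mem_nhds (show (φ x, T).1 ∈ φ.target from hx)
  obtain ⟨ε, hε, H⟩ := Metric.eventually_nhds_iff_ball.1 ((e1.and e2).and e3)
  refine ⟨T, ε, hε, ε, hε, fun y hy v hv ↦ ?_⟩
  obtain ⟨⟨h1, h2⟩, h3⟩ := H (y, v) (by rw [← ball_prod_same]; exact ⟨hy, hv⟩)
  refine ⟨h3, ?_, h1.le, h2⟩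
  intro h0
  simp only [V] at h1
  rw [h0] at h1
  simp at h1

/-- Segments in a chart whose direction is causal are causal curves. -/
lemma TimeOrientation.isFutureCausalCurve_extChartAt_symm (o : TimeOrientation g) (x : M)
    {u v : E} {s : ℝ} (hs : 0 < s)
    (h : ∀ t ∈ Icc 0 s, u + t • v ∈ (extChartAt 𝓘(ℝ, E) x).target ∧
      o.IsFutureCausal (mfderiv 𝓘(ℝ, E) 𝓘(ℝ, E) (extChartAt 𝓘(ℝ, E) x).symm (u + t • v) v)) :
    o.IsFutureCausalCurve (fun t ↦ (extChartAt 𝓘(ℝ, E) x).symm (u + t • v)) 0 s := by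
  have : IsManifold 𝓘(ℝ, E) 1 M := .of_le (n := ∞) (by norm_num)
  have hsm : ∀ y ∈ (extChartAt 𝓘(ℝ, E) x).target,
      ContMDiffAt 𝓘(ℝ, E) 𝓘(ℝ, E) 1 (extChartAt 𝓘(ℝ, E) x).symm y := fun y hy ↦
    (contMDiffOn_extChartAt_symm x).contMDiffAt ((isOpen_extChartAt_target x).mem_nhds hy)
  have hline : ContDiff ℝ 1 (fun t : ℝ ↦ u + t • v) := by fun_prop
  refine ⟨hs, isLocLipschitzPath_of_contMDiffAt fun t ht ↦ ?_, ?_⟩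
  · exact (hsm _ (h t ht).1).comp t hline.contMDiff.contMDiffAt
  · rw [ae_restrict_iff' measurableSet_Icc]
    refine Filter.Eventually.of_forall fun t ht ↦ ?_
    have hd : HasMFDerivAt 𝓘(ℝ, ℝ) 𝓘(ℝ, E) (fun t : ℝ ↦ u + t • v) t
        (ContinuousLinearMap.toSpanSingleton ℝ v) := by
      have : HasDerivAt (fun t : ℝ ↦ u + t • v) v t := by
        simpa using ((hasDerivAt_id t).smul_const v).const_add u
      exact this.hasFDerivAt.hasMFDerivAt
    have hcomp := HasMFDerivAt.comp t
      ((hsm _ (h t ht).1).mdifferentiableAt one_ne_zero).hasMFDerivAt hd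
    refine ⟨hcomp.mdifferentiableAt, ?_⟩
    have h4 : (mfderiv 𝓘(ℝ, ℝ) 𝓘(ℝ, E) (fun t ↦ (extChartAt 𝓘(ℝ, E) x).symm (u + t • v)) t :
        ℝ →L[ℝ] E) (1 : ℝ) =
        (mfderiv 𝓘(ℝ, E) 𝓘(ℝ, E) (extChartAt 𝓘(ℝ, E) x).symm (u + t • v) : E →L[ℝ] E) v := by
      have h5 : (mfderiv 𝓘(ℝ, ℝ) 𝓘(ℝ, E) (fun t ↦ (extChartAt 𝓘(ℝ, E) x).symm (u + t • v)) t :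
          ℝ →L[ℝ] E) =
          (mfderiv 𝓘(ℝ, E) 𝓘(ℝ, E) (extChartAt 𝓘(ℝ, E) x).symm (u + t • v) : E →L[ℝ] E).comp
          (ContinuousLinearMap.toSpanSingleton ℝ v) := hcomp.mfderiv
      have h6 : ∀ L : E →L[ℝ] E, L.comp (ContinuousLinearMap.toSpanSingleton ℝ v) (1 : ℝ) =
          L v := fun L ↦ by simp
      rw [h5]
      exact h6 _
    exact h4 ▸ (h t ht).2

lemma TimeOrientation.nullDist_le_abs_sub (τ : M → ℝ) {γ : ℝ → M} {a b : ℝ}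
    (h : o.IsFutureCausalCurve γ a b ∨ o.IsPastCausalCurve γ a b) :
    o.nullDist τ (γ a) (γ b) ≤ ENNReal.ofReal |τ (γ b) - τ (γ a)| := by
  have := o.nullDist_le τ (β := γ) (k := 1) (s := fun i ↦ if i = 0 then a else b)
    ⟨one_pos, fun i hi ↦ by
      obtain rfl : i = 0 := by omega
      simpa using h⟩
  simpa [nullLength] using this

/-- The null distance of a continuous function is locally bounded. -/
lemma TimeOrientation.exists_nullDist_le (o : TimeOrientation g) {τ : M → ℝ} (hτ : Continuous τ)
    (x : M) : ∃ U ∈ 𝓝 x, ∀ y ∈ U, ∀ z ∈ U, o.nullDist τ y z ≤ 4 := by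
  obtain ⟨T, δ, hδ, r₁, hr₁, H⟩ := o.exists_isFutureCausal_mfderiv_extChartAt_symm x
  set φ := extChartAt 𝓘(ℝ, E) x with hφ
  have hcont : ContinuousAt (τ ∘ φ.symm) (φ x) :=
    hτ.continuousAt.comp (continuousAt_extChartAt_symm x)
  obtain ⟨r₂, hr₂, H₂⟩ := Metric.continuousAt_iff.1 hcont 1 one_pos
  obtain ⟨r, hr, h1, h2⟩ : ∃ r > 0, r ≤ r₁ ∧ r ≤ r₂ :=
    ⟨min r₁ r₂, lt_min hr₁ hr₂, min_le_left _ _, min_le_right _ _⟩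
  have hosc : ∀ y ∈ ball (φ x) r, ∀ z ∈ ball (φ x) r, |τ (φ.symm y) - τ (φ.symm z)| ≤ 2 := by
    intro y hy z hz
    have a1 := H₂ (ball_subset_ball h2 hy)
    have a2 := H₂ (ball_subset_ball h2 hz)
    simp only [Function.comp_apply, Real.dist_eq] at a1 a2
    rw [abs_lt] at a1 a2
    rw [abs_le]
    constructor <;> linarith [a1.1, a1.2, a2.1, a2.2]
  -- In time `s` a velocity in `ball T δ` moves a point by at most `r / 2`, so segments starting in
  -- `ball (φ x) ρ` remain in `ball (φ x) r`. The bound `ρ ≤ s * δ / 2` ensures `‖φ z - φ y‖ < s *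
  -- δ`.
  obtain ⟨s, hs, hsr⟩ : ∃ s > 0, s * (‖T‖ + δ) ≤ r / 2 := by
    have : 0 < ‖T‖ + δ := by positivity
    exact ⟨r / 2 / (‖T‖ + δ), by positivity, by rw [div_mul_cancel₀ _ this.ne']⟩
  obtain ⟨ρ, hρ, hρr, hρs⟩ : ∃ ρ > 0, ρ ≤ r / 2 ∧ ρ ≤ s * δ / 2 :=
    ⟨min (r / 2) (s * δ / 2), by positivity, min_le_left _ _, min_le_right _ _⟩
  have hstay : ∀ u ∈ ball (φ x) ρ, ∀ v ∈ ball T δ, ∀ t ∈ Icc 0 s, u + t • v ∈ ball (φ x) r := by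
    intro u hu v hv t ht
    rw [mem_ball, dist_eq_norm] at hu hv ⊢
    have hvn : ‖v‖ ≤ ‖T‖ + δ := by
      have : ‖v‖ ≤ ‖T‖ + ‖v - T‖ := norm_le_norm_add_norm_sub' v T
      linarith
    have : ‖t • v‖ ≤ s * (‖T‖ + δ) := by
      rw [norm_smul, Real.norm_of_nonneg ht.1]
      exact mul_le_mul ht.2 hvn (norm_nonneg _) hs.le
    calc ‖u + t • v - φ x‖ = ‖(u - φ x) + t • v‖ := by congr 1; abel
      _ ≤ ‖u - φ x‖ + ‖t • v‖ := norm_add_le _ _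
      _ < r := by linarith
  have hcurve : ∀ u ∈ ball (φ x) ρ, ∀ v ∈ ball T δ,
      o.IsFutureCausalCurve (fun t ↦ φ.symm (u + t • v)) 0 s := fun u hu v hv ↦
    o.isFutureCausalCurve_extChartAt_symm x hs fun t ht ↦
      H _ (ball_subset_ball h1 (hstay u hu v hv t ht)) _ hv
  have hs0 : s ∈ Icc 0 s := ⟨hs.le, le_rfl⟩
  have ho0 : (0 : ℝ) ∈ Icc 0 s := ⟨le_rfl, hs.le⟩
  have hT : T ∈ ball T δ := mem_ball_self hδ
  refine ⟨φ.source ∩ φ ⁻¹' ball (φ x) ρ, Filter.inter_mem (extChartAt_source_mem_nhds x)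
    ((continuousAt_extChartAt x).preimage_mem_nhds (ball_mem_nhds _ hρ)), ?_⟩
  rintro y ⟨hys, hy⟩ z ⟨hzs, hz⟩
  rw [mem_preimage] at hy hz
  -- The zigzag: from `φ y`, this velocity reaches `φ z + s • T` in time `s`, and the reversed
  -- segment of velocity `T` leads from there to `φ z`.
  have hv : T + s⁻¹ • (φ z - φ y) ∈ ball T δ := by
    rw [mem_ball, dist_eq_norm, add_sub_cancel_left, norm_smul, norm_inv,
      Real.norm_of_nonneg hs.le, inv_mul_lt_iff₀ hs, ← dist_eq_norm]
    have := dist_triangle_right (φ z) (φ y) (φ x)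
    rw [mem_ball] at hy hz
    linarith
  have hend : φ y + s • (T + s⁻¹ • (φ z - φ y)) = φ z + s • T := by
    rw [smul_add, smul_inv_smul₀ hs.ne']; abel
  have hfirst := o.nullDist_le_abs_sub τ (.inl (hcurve _ hy _ hv))
  have hsecond := o.nullDist_le_abs_sub τ (.inr (IsCurveWith.comp_sub_left
    (Q := fun _ v ↦ o.IsPastCausal v) (hcurve _ hz _ hT) s
    (fun _ v h ↦ show o.IsFutureCausal (- -v) by rwa [neg_neg])))
  have b1 := hosc _ (hstay _ hy _ hv _ hs0) _ (hstay _ hy _ hv _ ho0)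
  have b2 := hosc _ (hstay _ hz _ hT _ ho0) _ (hstay _ hz _ hT _ hs0)
  rw [hend] at hfirst b1
  simp only [zero_smul, add_zero, sub_self, sub_zero, φ.left_inv hys, φ.left_inv hzs]
    at hfirst hsecond b1 b2
  calc o.nullDist τ y z ≤ _ := o.nullDist_triangle τ y (φ.symm (φ z + s • T)) z
    _ ≤ ENNReal.ofReal 2 + ENNReal.ofReal 2 := add_le_add
        (hfirst.trans (ENNReal.ofReal_le_ofReal b1)) (hsecond.trans (ENNReal.ofReal_le_ofReal b2))
    _ = 4 := by rw [← ENNReal.ofReal_add (by norm_num) (by norm_num)]; norm_num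

end LocalCausality

/-! ### Comparison of two admissible time functions. -/

section Comparison

open Metric

variable {E : Type*} [NormedAddCommGroup E] [NormedSpace ℝ E]
  {M : Type*} [TopologicalSpace M] [ChartedSpace E M] [IsManifold 𝓘(ℝ, E) ∞ M]
  {g : LorentzianMetric E M} {o : TimeOrientation g}

lemma TimeOrientation.IsTimeFunction.mono {τ : M → ℝ} (hτ : o.IsTimeFunction τ) {p q : M}
    (h : o.CausalLE p q) : τ p ≤ τ q := by
  by_cases hpq : p = q
  · rw [hpq]
  · exact (hτ.2 p q h hpq).le

lemma TimeOrientation.IsFutureCausalCurve.causalLE {γ : ℝ → M} {a b : ℝ}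
    (h : o.IsFutureCausalCurve γ a b) {t t' : ℝ} (ht : a ≤ t) (htt : t ≤ t') (ht' : t' ≤ b) :
    o.CausalLE (γ t) (γ t') := by
  rcases htt.eq_or_lt with rfl | htt
  · exact .inl rfl
  · exact .inr ⟨γ, t, t', IsCurveWith.mono h htt ht ht', rfl, rfl⟩

lemma TimeOrientation.IsPastCausalCurve.causalLE {γ : ℝ → M} {a b : ℝ}
    (h : o.IsPastCausalCurve γ a b) {t t' : ℝ} (ht : a ≤ t) (htt : t ≤ t') (ht' : t' ≤ b) :
    o.CausalLE (γ t') (γ t) := by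
  have h' : o.IsFutureCausalCurve (fun t ↦ γ (0 - t)) (0 - b) (0 - a) :=
    IsCurveWith.comp_sub_left (o.isPastCausalCurve_iff.1 h) 0 (fun _ _ h ↦ h)
  simpa using h'.causalLE (t := 0 - t') (t' := 0 - t) (by linarith) (by linarith) (by linarith)

/-- Along a causal curve, a time function moves away from its initial value. -/
lemma TimeOrientation.IsTimeFunction.abs_sub_le_abs_sub {τ : M → ℝ} (hτ : o.IsTimeFunction τ)
    {γ : ℝ → M} {a b : ℝ} (h : o.IsFutureCausalCurve γ a b ∨ o.IsPastCausalCurve γ a b) {t : ℝ}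
    (ht : t ∈ Icc a b) : |τ (γ t) - τ (γ a)| ≤ |τ (γ b) - τ (γ a)| := by
  rcases h with h | h
  · have h1 := hτ.mono (h.causalLE le_rfl ht.1 ht.2)
    have h2 := hτ.mono (h.causalLE ht.1 ht.2 le_rfl)
    rw [abs_of_nonneg (by linarith), abs_of_nonneg (by linarith)]
    linarith
  · have h1 := hτ.mono (h.causalLE le_rfl ht.1 ht.2)
    have h2 := hτ.mono (h.causalLE ht.1 ht.2 le_rfl)
    rw [abs_of_nonpos (by linarith), abs_of_nonpos (by linarith)]
    linarith

/-- Admissibility in terms of the distance in a chart. -/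
lemma TimeOrientation.IsAdmissible.exists_dist_extChartAt [RegularSpace M] {τ : M → ℝ}
    (hτ : o.IsAdmissible τ) (x : M) : ∃ U ∈ 𝓝 x, ∃ C : ℝ, 0 ≤ C ∧ ∀ p ∈ U, ∀ q ∈ U,
      o.CausalLE p q →
      dist (extChartAt 𝓘(ℝ, E) x p) (extChartAt 𝓘(ℝ, E) x q) ≤ C * (τ q - τ p) ∧
      τ q - τ p ≤ C * dist (extChartAt 𝓘(ℝ, E) x p) (extChartAt 𝓘(ℝ, E) x q) := by
  obtain ⟨ht, h, H⟩ := hτ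
  obtain ⟨U, hU, C, hC, HC⟩ := H x
  obtain ⟨C₁, U₁, hU₁, H₁⟩ := exists_riemDist_le_edist_extChartAt h x
  obtain ⟨C₂, U₂, hU₂, H₂⟩ := exists_edist_extChartAt_le_riemDist h x
  refine ⟨U ∩ (U₁ ∩ U₂), Filter.inter_mem hU (Filter.inter_mem hU₁ hU₂), C * max C₁ C₂,
    by positivity, ?_⟩
  rintro p ⟨hp, hp₁, hp₂⟩ q ⟨hq, hq₁, hq₂⟩ hpq
  obtain ⟨e₁, e₂⟩ := HC p hp q hq hpq
  have f₁ := H₁ p hp₁ q hq₁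
  have f₂ := H₂ p hp₂ q hq₂
  rw [edist_dist, ← ENNReal.ofReal_coe_nnreal] at f₁ f₂
  have hC0 : 0 < C := by linarith
  have hΔ : 0 ≤ τ q - τ p := sub_nonneg.2 (ht.mono hpq)
  constructor
  · have e₃ : riemDist h p q ≤ ENNReal.ofReal C * ENNReal.ofReal (τ q - τ p) := by
      rw [one_div, ENNReal.ofReal_inv_of_pos hC0, ENNReal.inv_mul_le_iff (by simpa using hC0)
        ENNReal.ofReal_ne_top] at e₁
      exact e₁
    have := f₂.trans (mul_le_mul_right e₃ _)
    rw [← ENNReal.ofReal_mul hC0.le, ← ENNReal.ofReal_mul C₂.coe_nonneg,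
      ENNReal.ofReal_le_ofReal_iff (by positivity)] at this
    calc _ ≤ _ := this
      _ = C * C₂ * (τ q - τ p) := by ring
      _ ≤ C * max C₁ C₂ * (τ q - τ p) := by gcongr; exact le_max_right _ _
  · have := e₂.trans (mul_le_mul_right f₁ _)
    rw [← ENNReal.ofReal_mul C₁.coe_nonneg, ← ENNReal.ofReal_mul hC0.le,
      ENNReal.ofReal_le_ofReal_iff (by positivity)] at this
    calc _ ≤ _ := this
      _ = C * C₁ * dist (extChartAt 𝓘(ℝ, E) x p) (extChartAt 𝓘(ℝ, E) x q) := by ring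
      _ ≤ _ := by gcongr; exact le_max_left _ _

/-- Near a point, the variations of two admissible time functions between causally related points
are comparable. -/
lemma TimeOrientation.IsAdmissible.exists_abs_sub_le [RegularSpace M] {τ₁ τ₂ : M → ℝ}
    (hτ₁ : o.IsAdmissible τ₁) (hτ₂ : o.IsAdmissible τ₂) (x : M) :
    ∃ U ∈ 𝓝 x, ∃ C : ℝ, 0 ≤ C ∧ ∀ p ∈ U, ∀ q ∈ U, (o.CausalLE p q ∨ o.CausalLE q p) →
      dist (extChartAt 𝓘(ℝ, E) x p) (extChartAt 𝓘(ℝ, E) x q) ≤ C * |τ₁ q - τ₁ p| ∧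
      |τ₂ q - τ₂ p| ≤ C * |τ₁ q - τ₁ p| := by
  obtain ⟨U₁, hU₁, C₁, hC₁, H₁⟩ := hτ₁.exists_dist_extChartAt x
  obtain ⟨U₂, hU₂, C₂, hC₂, H₂⟩ := hτ₂.exists_dist_extChartAt x
  -- Chain through the chart distance: Lipschitz bound for `τ₂`, then anti-Lipschitz bound for `τ₁`.
  have key : ∀ p ∈ U₁ ∩ U₂, ∀ q ∈ U₁ ∩ U₂, o.CausalLE p q →
      dist (extChartAt 𝓘(ℝ, E) x p) (extChartAt 𝓘(ℝ, E) x q) ≤ C₁ * |τ₁ q - τ₁ p| ∧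
      |τ₂ q - τ₂ p| ≤ C₂ * C₁ * |τ₁ q - τ₁ p| := by
    rintro p ⟨hp₁, hp₂⟩ q ⟨hq₁, hq₂⟩ hpq
    rw [abs_of_nonneg (sub_nonneg.2 (hτ₁.1.mono hpq)), abs_of_nonneg (sub_nonneg.2 (hτ₂.1.mono hpq))]
    have e₁ := (H₁ p hp₁ q hq₁ hpq).1
    refine ⟨e₁, (H₂ p hp₂ q hq₂ hpq).2.trans ?_⟩
    rw [mul_assoc]
    exact mul_le_mul_of_nonneg_left e₁ hC₂
  refine ⟨U₁ ∩ U₂, Filter.inter_mem hU₁ hU₂, max C₁ (C₂ * C₁), le_max_of_le_left hC₁,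
    fun p hp q hq hpq ↦ ?_⟩
  have : dist (extChartAt 𝓘(ℝ, E) x p) (extChartAt 𝓘(ℝ, E) x q) ≤ C₁ * |τ₁ q - τ₁ p| ∧
      |τ₂ q - τ₂ p| ≤ C₂ * C₁ * |τ₁ q - τ₁ p| := by
    rcases hpq with hpq | hpq
    · exact key p hp q hq hpq
    · rw [dist_comm, abs_sub_comm (τ₁ q), abs_sub_comm (τ₂ q)]
      exact key q hq p hp hpq
  exact ⟨this.1.trans (by gcongr; exact le_max_left _ _),
    this.2.trans (by gcongr; exact le_max_right _ _)⟩

lemma nullLength_mono {X : Type*} (τ : X → ℝ) (β : ℝ → X) (s : ℕ → ℝ) {j k : ℕ} (h : j ≤ k) :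
    nullLength τ β j s ≤ nullLength τ β k s :=
  Finset.sum_le_sum_of_subset_of_nonneg (Finset.range_mono h) fun _ _ _ ↦ abs_nonneg _

/-- Such a manifold is locally compact, and locally compact Hausdorff spaces are regular. Regularity
lets the Riemannian distance control the topology. -/
lemma regularSpace_of_finiteDimensional (E : Type*) [NormedAddCommGroup E] [NormedSpace ℝ E]
    [FiniteDimensional ℝ E] (M : Type*) [TopologicalSpace M] [ChartedSpace E M] [T2Space M] :
    RegularSpace M := by
  have : LocallyCompactSpace M := Manifold.locallyCompact_of_finiteDimensional 𝓘(ℝ, E)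
  infer_instance

/-- Otherwise the interior of `u` and the complement of its closure would disconnect `t`. -/
lemma nonempty_inter_frontier_of_isPreconnected {X : Type*} [TopologicalSpace X] {t u : Set X}
    (ht : IsPreconnected t) (h : (t ∩ u).Nonempty) (h' : (t ∩ uᶜ).Nonempty) :
    (t ∩ frontier u).Nonempty := by
  by_contra hf
  have hdis : ∀ y ∈ t, y ∉ frontier u := fun y hy hy' ↦ hf ⟨y, hy, hy'⟩
  have hint : ∀ y ∈ t, y ∈ closure u → y ∈ interior u := fun y hy hc ↦ by
    by_contra hi
    exact hdis y hy ⟨hc, hi⟩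
  obtain ⟨y, hy, hyu⟩ := h
  obtain ⟨z, hz, hzu⟩ := h'
  obtain ⟨w, -, hw, hw'⟩ := ht (interior u) (closure u)ᶜ isOpen_interior isClosed_closure.isOpen_compl
    (fun y hy ↦ (em (y ∈ closure u)).imp (hint y hy) id)
    ⟨y, hy, hint y hy (subset_closure hyu)⟩
    ⟨z, hz, fun hc ↦ hzu (interior_subset (hint z hz hc))⟩
  exact hw' (subset_closure (interior_subset hw))

/-- Each point has a neighborhood such that a piecewise causal path starting in it either has
comparable null lengths for the two time functions, or has null length at least `ε`. -/
lemma TimeOrientation.IsAdmissible.exists_nullLength_le_or_le [FiniteDimensional ℝ E] [T2Space M]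
    {τ₁ τ₂ : M → ℝ} (hτ₁ : o.IsAdmissible τ₁) (hτ₂ : o.IsAdmissible τ₂) (x : M) :
    ∃ V ∈ 𝓝 x, ∃ C : ℝ, ∃ ε > 0, ∀ (β : ℝ → M) (k : ℕ) (s : ℕ → ℝ),
      o.IsPiecewiseCausal β k s → β (s 0) ∈ V →
      nullLength τ₂ β k s ≤ C * nullLength τ₁ β k s ∨ ε ≤ nullLength τ₁ β k s := by
  have := regularSpace_of_finiteDimensional E M
  have : ProperSpace E := FiniteDimensional.proper ℝ E
  obtain ⟨h, -⟩ := hτ₁.2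
  obtain ⟨U, hU, C, hC, H⟩ := hτ₁.exists_abs_sub_le hτ₂ x
  set φ := extChartAt 𝓘(ℝ, E) x with hφ
  have hpre : φ.target ∩ φ.symm ⁻¹' U ∈ 𝓝 (φ x) :=
    Filter.inter_mem (extChartAt_target_mem_nhds x) ((continuousAt_extChartAt_symm x).preimage_mem_nhds
      (by rwa [extChartAt_to_inv]))
  obtain ⟨R, hR, hRU⟩ := Metric.nhds_basis_closedBall.mem_iff.1 hpre
  have hopen : ∀ r, IsOpen (φ.source ∩ φ ⁻¹' ball (φ x) r) := fun r ↦
    (continuousOn_extChartAt x).isOpen_inter_preimage (isOpen_extChartAt_source x) isOpen_ball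
  set W := φ.source ∩ φ ⁻¹' ball (φ x) R with hW
  set N := φ.symm '' closedBall (φ x) R with hN
  have hNU : N ⊆ U := by
    rintro _ ⟨y, hy, rfl⟩
    exact (hRU hy).2
  -- Compact, hence closed since `M` is Hausdorff. This keeps the closure of `W` inside the chart,
  -- so frontier points lie on the sphere of radius `R`.
  have hNclosed : IsClosed N :=
    ((isCompact_closedBall _ _).image_of_continuousOn
      ((continuousOn_extChartAt_symm x).mono fun y hy ↦ (hRU hy).1)).isClosed
  have hWN : W ⊆ N := fun y hy ↦ ⟨φ y, ball_subset_closedBall hy.2, φ.left_inv hy.1⟩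
  have hWU : W ⊆ U := hWN.trans hNU
  have hfr : ∀ y ∈ frontier W, y ∈ U ∧ dist (φ y) (φ x) = R := by
    intro y hy
    rw [(hopen R).frontier_eq] at hy
    obtain ⟨z, hz, rfl⟩ := hNclosed.closure_subset_iff.2 hWN hy.1
    have hzt := (hRU hz).1
    refine ⟨(hRU hz).2, ?_⟩
    rw [φ.right_inv hzt]
    refine le_antisymm hz (not_lt.1 fun hlt ↦ hy.2 ⟨φ.map_target hzt, ?_⟩)
    rwa [mem_preimage, φ.right_inv hzt]
  -- Starting in the half ball, a path has to cover chart distance `R / 2` to reach the frontier of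
  -- `W`. The `C + 1` avoids dividing by zero.
  refine ⟨φ.source ∩ φ ⁻¹' ball (φ x) (R / 2), (hopen _).mem_nhds
    ⟨mem_extChartAt_source x, mem_ball_self (by positivity)⟩, C, R / 2 / (C + 1), by positivity,
    fun β k s hβ h0 ↦ ?_⟩
  have h0W : β (s 0) ∈ W := ⟨h0.1, ball_subset_ball (by linarith) h0.2⟩
  -- Only break points matter for null length, so the pieces between them may leave `W`.
  by_cases hall : ∀ i ≤ k, β (s i) ∈ W
  · left
    unfold nullLength
    rw [Finset.mul_sum]
    refine Finset.sum_le_sum fun i hi ↦ ?_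
    have hi := Finset.mem_range.1 hi
    exact (H _ (hWU (hall i hi.le)) _ (hWU (hall (i + 1) hi))
      (o.causalLE_or_causalLE (hβ.2 i hi))).2
  right
  push Not at hall
  classical
  -- Up to the first break point outside `W` the local estimates apply. The piece ending there is
  -- cut where it meets the frontier.
  have hj := Nat.find_spec hall
  have hmin : ∀ i < Nat.find hall, β (s i) ∈ W := fun i hi ↦ by
    by_contra hc
    exact Nat.find_min hall hi ⟨hi.le.trans hj.1, hc⟩
  obtain ⟨i, hi⟩ : ∃ i, Nat.find hall = i + 1 := by
    refine Nat.exists_eq_succ_of_ne_zero fun h ↦ ?_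
    rw [h] at hj
    exact hj.2 h0W
  rw [hi] at hj hmin
  have hik : i < k := hj.1
  have hcurve := hβ.2 i hik
  have hlt : s i < s (i + 1) := hcurve.elim (·.1) (·.1)
  have hcont : ContinuousOn β (Icc (s i) (s (i + 1))) :=
    IsLocLipschitzPath.continuousOn (hcurve.elim (·.2.1) (·.2.1)) h
  obtain ⟨_, ⟨t, ht, rfl⟩, htW⟩ := nonempty_inter_frontier_of_isPreconnected
    (isPreconnected_Icc.image β hcont) (u := W) ⟨_, mem_image_of_mem β (left_mem_Icc.2 hlt.le), hmin i (Nat.lt_succ_self i)⟩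
    ⟨_, mem_image_of_mem β (right_mem_Icc.2 hlt.le), hj.2⟩
  obtain ⟨htU, htR⟩ := hfr _ htW
  have hpart : ∀ j ≤ i, dist (φ (β (s 0))) (φ (β (s j))) ≤ C * nullLength τ₁ β j s := by
    intro j hji
    unfold nullLength
    rw [Finset.mul_sum]
    refine (dist_le_range_sum_dist (fun j ↦ φ (β (s j))) j).trans
      (Finset.sum_le_sum fun l hl ↦ ?_)
    have hl := Finset.mem_range.1 hl
    exact (H _ (hWU (hmin l (by omega))) _ (hWU (hmin (l + 1) (by omega)))
      (o.causalLE_or_causalLE (hβ.2 l (by omega)))).1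
  have hlast : dist (φ (β (s i))) (φ (β t)) ≤ C * |τ₁ (β (s (i + 1))) - τ₁ (β (s i))| := by
    have hrel : o.CausalLE (β (s i)) (β t) ∨ o.CausalLE (β t) (β (s i)) :=
      hcurve.imp (·.causalLE le_rfl ht.1 ht.2) (·.causalLE le_rfl ht.1 ht.2)
    exact (H _ (hWU (hmin i (Nat.lt_succ_self i))) _ htU hrel).1.trans
      (mul_le_mul_of_nonneg_left (hτ₁.1.abs_sub_le_abs_sub hcurve ht) hC)
  have hsum : nullLength τ₁ β i s + |τ₁ (β (s (i + 1))) - τ₁ (β (s i))| ≤ nullLength τ₁ β k s := by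
    have := nullLength_mono τ₁ β s hj.1
    rwa [nullLength, Finset.sum_range_succ] at this
  have h0' : dist (φ (β (s 0))) (φ x) < R / 2 := h0.2
  have htri : R ≤ dist (φ (β (s 0))) (φ (β (s i))) + dist (φ (β (s i))) (φ (β t)) +
      dist (φ (β (s 0))) (φ x) := by
    rw [← htR]
    have e₁ := dist_triangle_left (φ (β t)) (φ x) (φ (β (s 0)))
    have e₂ := dist_triangle (φ (β (s 0))) (φ (β (s i))) (φ (β t))
    linarith
  have hCL : R / 2 ≤ C * nullLength τ₁ β k s := by
    have := mul_le_mul_of_nonneg_left hsum hC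
    rw [mul_add] at this
    linarith [hpart i le_rfl]
  rw [div_le_iff₀ (by positivity)]
  linarith [nullLength_nonneg τ₁ β k s]

/-- On a compact set, the null distance is bounded where it is finite. -/
lemma TimeOrientation.exists_nullDist_le_of_isCompact {τ : M → ℝ} (hτ : Continuous τ) {K : Set M}
    (hK : IsCompact K) :
    ∃ D : ℝ, ∀ p ∈ K, ∀ q ∈ K, o.nullDist τ p q < ⊤ → o.nullDist τ p q ≤ ENNReal.ofReal D := by
  suffices h : ∃ D : ℝ, ∀ z ∈ K ×ˢ K, o.nullDist τ z.1 z.2 < ⊤ →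
      o.nullDist τ z.1 z.2 ≤ ENNReal.ofReal D by
    obtain ⟨D, hD⟩ := h
    exact ⟨D, fun p hp q hq ↦ hD (p, q) ⟨hp, hq⟩⟩
  refine (hK.prod hK).induction_on (p := fun S ↦ ∃ D : ℝ, ∀ z ∈ S, o.nullDist τ z.1 z.2 < ⊤ →
      o.nullDist τ z.1 z.2 ≤ ENNReal.ofReal D) ⟨0, by simp⟩ ?_ ?_ ?_
  · rintro S T hST ⟨D, hD⟩
    exact ⟨D, fun z hz ↦ hD z (hST hz)⟩
  · rintro S T ⟨D, hD⟩ ⟨D', hD'⟩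
    refine ⟨max D D', fun z hz hlt ↦ ?_⟩
    rcases hz with hz | hz
    · exact (hD z hz hlt).trans (ENNReal.ofReal_le_ofReal (le_max_left _ _))
    · exact (hD' z hz hlt).trans (ENNReal.ofReal_le_ofReal (le_max_right _ _))
  · rintro ⟨p₀, q₀⟩ -
    obtain ⟨U, hU, HU⟩ := o.exists_nullDist_le hτ p₀
    obtain ⟨V, hV, HV⟩ := o.exists_nullDist_le hτ q₀
    refine ⟨U ×ˢ V, mem_nhdsWithin_of_mem_nhds (prod_mem_nhds hU hV), ?_⟩
    -- One finite value in the product neighborhood bounds all the others, by moving both endpoints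
    -- at cost 4 each.
    by_cases hex : ∃ z ∈ U ×ˢ V, o.nullDist τ z.1 z.2 < ⊤
    · obtain ⟨z₀, hz₀, hlt⟩ := hex
      refine ⟨(4 + (o.nullDist τ z₀.1 z₀.2 + 4)).toReal, fun z hz _ ↦ ?_⟩
      rw [ENNReal.ofReal_toReal (by simp [hlt.ne])]
      refine (o.nullDist_triangle τ z.1 z₀.1 z.2).trans (add_le_add (HU _ hz.1 _ hz₀.1) ?_)
      exact (o.nullDist_triangle τ z₀.1 z₀.2 z.2).trans (add_le_add le_rfl (HV _ hz₀.2 _ hz.2))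
    · exact ⟨0, fun z hz hlt ↦ (hex ⟨z, hz, hlt⟩).elim⟩

/-- On a compact set, the null distance of an admissible time function is bounded by a multiple of
the null distance of any other one. -/
lemma TimeOrientation.IsAdmissible.exists_nullDist_le_mul [FiniteDimensional ℝ E] [T2Space M]
    {τ₁ τ₂ : M → ℝ} (hτ₁ : o.IsAdmissible τ₁) (hτ₂ : o.IsAdmissible τ₂) {K : Set M}
    (hK : IsCompact K) : ∃ C : ℝ, 1 ≤ C ∧ ∀ p ∈ K, ∀ q ∈ K,
      o.nullDist τ₂ p q ≤ ENNReal.ofReal C * o.nullDist τ₁ p q := by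
  obtain ⟨D, hD⟩ := o.exists_nullDist_le_of_isCompact hτ₂.1.1 hK
  -- The sets in the compactness induction need not lie in `K`, so `p ∈ K`, needed for the bound
  -- `D`, is kept as a separate hypothesis.
  suffices h : ∃ C : ℝ, 1 ≤ C ∧ ∀ p ∈ K, p ∈ K → ∀ q ∈ K,
      o.nullDist τ₂ p q ≤ ENNReal.ofReal C * o.nullDist τ₁ p q by
    obtain ⟨C, hC, H⟩ := h
    exact ⟨C, hC, fun p hp ↦ H p hp hp⟩
  refine hK.induction_on (p := fun S ↦ ∃ C : ℝ, 1 ≤ C ∧ ∀ p ∈ S, p ∈ K → ∀ q ∈ K,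
      o.nullDist τ₂ p q ≤ ENNReal.ofReal C * o.nullDist τ₁ p q) ⟨1, le_rfl, by simp⟩ ?_ ?_ ?_
  · rintro S T hST ⟨C, hC, H⟩
    exact ⟨C, hC, fun p hp ↦ H p (hST hp)⟩
  · rintro S T ⟨C, hC, H⟩ ⟨C', -, H'⟩
    refine ⟨max C C', le_max_of_le_left hC, fun p hp hpK q hq ↦ ?_⟩
    rcases hp with hp | hp
    · exact (H p hp hpK q hq).trans
        (mul_le_mul_left (ENNReal.ofReal_le_ofReal (le_max_left _ _)) _)
    · exact (H' p hp hpK q hq).trans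
        (mul_le_mul_left (ENNReal.ofReal_le_ofReal (le_max_right _ _)) _)
  · intro x _
    obtain ⟨V, hV, C, ε, hε, H⟩ := hτ₁.exists_nullLength_le_or_le hτ₂ x
    refine ⟨V, mem_nhdsWithin_of_mem_nhds hV, max 1 (max C (D / ε)), le_max_left _ _,
      fun p hp hpK q hq ↦ ?_⟩
    set C' := max 1 (max C (D / ε)) with hC'
    have hC'0 : 0 < C' := one_pos.trans_le (le_max_left _ _)
    -- A failure yields a path whose `τ₁`-length times `C'` is below the `τ₂`-distance. Short paths
    -- contradict this through `C`, long ones through `D / ε`.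
    by_contra! hlt
    rw [mul_comm, ← ENNReal.lt_div_iff_mul_lt (.inl (by simpa using hC'0))
      (.inl ENNReal.ofReal_ne_top)] at hlt
    obtain ⟨β, k, s, hβ, rfl, rfl, hl⟩ := o.exists_of_nullDist_lt hlt
    rw [ENNReal.lt_div_iff_mul_lt (.inl (by simpa using hC'0)) (.inl ENNReal.ofReal_ne_top),
      ← ENNReal.ofReal_mul (nullLength_nonneg ..)] at hl
    refine hl.not_ge ?_
    have hL := nullLength_nonneg τ₁ β k s
    rcases H β k s hβ hp with h | h
    · refine (o.nullDist_le τ₂ hβ).trans (ENNReal.ofReal_le_ofReal (h.trans ?_))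
      rw [mul_comm]
      gcongr
      exact (le_max_left _ _).trans (le_max_right _ _)
    · refine (hD _ hpK _ hq (o.nullDist_lt_top_of_isPiecewiseCausal τ₂ hβ)).trans
        (ENNReal.ofReal_le_ofReal ?_)
      have h1 : D / ε ≤ C' := (le_max_right _ _).trans (le_max_right _ _)
      rw [div_le_iff₀ hε] at h1
      calc D ≤ C' * ε := h1
        _ ≤ C' * nullLength τ₁ β k s := by gcongr
        _ = _ := mul_comm _ _

end Comparison

end NullDistance

theorem mainTheorem6
    {E : Type*} [NormedAddCommGroup E] [NormedSpace ℝ E] [FiniteDimensional ℝ E]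
    {M : Type*} [TopologicalSpace M] [T2Space M] [SecondCountableTopology M]
    [ChartedSpace E M] [IsManifold 𝓘(ℝ, E) ∞ M]
    (g : NullDistance.LorentzianMetric E M) (o : NullDistance.TimeOrientation g)
    (τ₁ τ₂ : M → ℝ) (hτ₁ : o.IsAdmissible τ₁) (hτ₂ : o.IsAdmissible τ₂)
    (K : Set M) (hK : IsCompact K) :
    ∃ C : ℝ, 1 ≤ C ∧ ∀ p ∈ K, ∀ q ∈ K,
      ENNReal.ofReal (1 / C) * o.nullDist τ₁ p q ≤ o.nullDist τ₂ p q ∧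
      o.nullDist τ₂ p q ≤ ENNReal.ofReal C * o.nullDist τ₁ p q := by
  obtain ⟨C, hC, H⟩ := hτ₁.exists_nullDist_le_mul hτ₂ hK
  obtain ⟨C', hC', H'⟩ := hτ₂.exists_nullDist_le_mul hτ₁ hK
  have h0 : 0 < max C C' := one_pos.trans_le (le_max_of_le_left hC)
  refine ⟨max C C', le_max_of_le_left hC, fun p hp q hq ↦ ⟨?_, ?_⟩⟩
  · rw [one_div, ENNReal.ofReal_inv_of_pos h0, ENNReal.inv_mul_le_iff (ENNReal.ofReal_pos.2 h0).ne'
      ENNReal.ofReal_ne_top]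
    exact (H' p hp q hq).trans
      (mul_le_mul_left (ENNReal.ofReal_le_ofReal (le_max_right _ _)) _)
  · exact (H p hp q hq).trans
      (mul_le_mul_left (ENNReal.ofReal_le_ofReal (le_max_left _ _)) _)
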